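/- Let $M$ be a finite-dimensional smooth manifold with a smooth pseudo-Riemannian metric $G$ (of any signature) and Levi-Civita connection $\nabla$, let $e : Y \to M$ be an embedded smooth submanifold, and let $F$ be a closed smooth 2-form on $Y$; regard $TY$ as a subbundle of $e^*TM$ via $de$. Suppose that $(Y,F)$ is a topological bibrane, i.e. at every point of $Y$ the following holds: if $u \in TY$ and $v \in e^*TM$ satisfy $G(v,w) = F(u,w)$ for all $w \in TY$, then $v \in TY$ and $G(u,w) = F(v,w)$ for all $w \in TY$. Let \[ \mathcal R_+ = \{\, u \in TY : G(u,w) = F(u,w) \ \text{for all } w \in TY \,\}. \] If $\mathcal R_+$ is integrable (through every point of $Y$ there passes an immersed smooth submanifold of $Y$ whose tangent space at each of its points is $\mathcal R_+$), then $\mathcal R_+$ is parallel along $TY$ for the pullback connection $e^*\nabla$ on $e^*TM$: for every smooth section $s$ of $\mathcal R_+$, every $y \in Y$ and every $u \in T_yY$, \[ (e^*\nabla)_u s \in (\mathcal R_+)_y . \] -/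

import Mathlib

open Bundle Set
open scoped Manifold ContDiff Topology

noncomputable section

namespace Bibrane

variable {E : Type*} [NormedAddCommGroup E] [NormedSpace ℝ E]
  {M : Type*} [TopologicalSpace M] [ChartedSpace E M] [IsManifold 𝓘(ℝ, E) ∞ M]
  {E' : Type*} [NormedAddCommGroup E'] [NormedSpace ℝ E']
  {Y : Type*} [TopologicalSpace Y] [ChartedSpace E' Y] [IsManifold 𝓘(ℝ, E') ∞ Y]

instance [FiniteDimensional ℝ E] (x : M) : FiniteDimensional ℝ (TangentSpace 𝓘(ℝ, E) x) :=
  inferInstanceAs (FiniteDimensional ℝ E)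

instance (x : M) : T2Space (TangentSpace 𝓘(ℝ, E) x) :=
  inferInstanceAs (T2Space E)

/-- A smooth pseudo-Riemannian metric on `M`. -/
structure PseudoRiemannianMetric (E : Type*) [NormedAddCommGroup E] [NormedSpace ℝ E]
    (M : Type*) [TopologicalSpace M] [ChartedSpace E M] [IsManifold 𝓘(ℝ, E) ∞ M] where
  val (x : M) : TangentSpace 𝓘(ℝ, E) x →L[ℝ] TangentSpace 𝓘(ℝ, E) x →L[ℝ] ℝ
  symm (x : M) (v w : TangentSpace 𝓘(ℝ, E) x) : val x v w = val x w v
  nondegenerate (x : M) (v : TangentSpace 𝓘(ℝ, E) x) (hv : ∀ w, val x v w = 0) : v = 0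
  contMDiff : ContMDiff 𝓘(ℝ, E) (𝓘(ℝ, E).prod 𝓘(ℝ, E →L[ℝ] E →L[ℝ] ℝ)) ∞
    (fun x ↦ TotalSpace.mk' (E →L[ℝ] E →L[ℝ] ℝ) x (val x))

/-- The components of a tangent vector at `x'` in the coordinate frame of the preferred chart
at `x`. -/
def toCoords (x x' : M) : TangentSpace 𝓘(ℝ, E) x' →L[ℝ] E :=
  (trivializationAt E (TangentSpace 𝓘(ℝ, E)) x).continuousLinearMapAt ℝ x'

/-- The tangent vector at `x'` with given components in the coordinate frame of the preferred
chart at `x`. -/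
def ofCoords (x x' : M) : E →L[ℝ] TangentSpace 𝓘(ℝ, E) x' :=
  (trivializationAt E (TangentSpace 𝓘(ℝ, E)) x).symmL ℝ x'

theorem ofCoords_toCoords (x x' : M) (hx : x' ∈ (chartAt E x).source)
    (v : TangentSpace 𝓘(ℝ, E) x') : ofCoords x x' (toCoords x x' v) = v :=
  (trivializationAt E (TangentSpace 𝓘(ℝ, E)) x).symmL_continuousLinearMapAt hx v

theorem toCoords_ofCoords (x x' : M) (hx : x' ∈ (chartAt E x).source)
    (v : E) : toCoords x x' (ofCoords x x' v) = v :=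
  (trivializationAt E (TangentSpace 𝓘(ℝ, E)) x).continuousLinearMapAt_symmL hx v

theorem toCoords_eventuallyEq (x : M) (σ : ∀ x : M, TangentSpace 𝓘(ℝ, E) x) :
    (fun x' ↦ toCoords x x' (σ x')) =ᶠ[𝓝 x]
      fun x' ↦ (trivializationAt E (TangentSpace 𝓘(ℝ, E)) x ⟨x', σ x'⟩).2 := by
  filter_upwards [(chartAt E x).open_source.mem_nhds (mem_chart_source E x)] with x' hx'
  exact by
    have h : x' ∈ (trivializationAt E (TangentSpace 𝓘(ℝ, E)) x).baseSet := hx'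
    simp only [toCoords, Trivialization.continuousLinearMapAt_apply,
      Trivialization.coe_linearMapAt_of_mem _ h]

theorem mdifferentiableAt_toCoords {x : M} {σ : ∀ x : M, TangentSpace 𝓘(ℝ, E) x}
    (hσ : MDifferentiableAt 𝓘(ℝ, E) 𝓘(ℝ, E).tangent
      (fun x' ↦ (TotalSpace.mk' E x' (σ x') : TangentBundle 𝓘(ℝ, E) M)) x) :
    MDifferentiableAt 𝓘(ℝ, E) 𝓘(ℝ, E) (fun x' ↦ toCoords x x' (σ x')) x :=
  ((mdifferentiableAt_section _ _).1 hσ).congr_of_eventuallyEq (toCoords_eventuallyEq x σ)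

/-- Differentiation of the components of a vector field in the coordinate frame of the preferred
chart at each point. -/
def coordDerivative : CovariantDerivative 𝓘(ℝ, E) E (TangentSpace 𝓘(ℝ, E) : M → Type _) where
  toFun σ x := ofCoords x x ∘L mvfderiv 𝓘(ℝ, E) (fun x' ↦ toCoords x x' (σ x')) x
  isCovariantDerivativeOnUniv :=
    { add := by
        intro σ σ' x hσ hσ' _
        have := mvfderiv_fun_add (mdifferentiableAt_toCoords hσ) (mdifferentiableAt_toCoords hσ')
        simp only [Pi.add_apply, map_add]
        rw [this, ContinuousLinearMap.comp_add]
      leibniz := by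
        intro σ g x hσ hg _
        have := mvfderiv_fun_smul hg (mdifferentiableAt_toCoords hσ)
        simp only [Pi.smul_apply', map_smul]
        rw [this]
        ext v
        simp [ofCoords_toCoords x x (mem_chart_source E x)] }

/-- The components `g_ij(x')` of the metric in the coordinate frame of the preferred chart at `x`. -/
def metricCoords (G : PseudoRiemannianMetric E M) (x x' : M) : E →L[ℝ] E →L[ℝ] ℝ :=
  ContinuousLinearMap.precomp ℝ (ofCoords x x') ∘L G.val x' ∘L ofCoords x x'

theorem mdifferentiableAt_metricCoords (G : PseudoRiemannianMetric E M) (x : M) :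
    MDifferentiableAt 𝓘(ℝ, E) 𝓘(ℝ, E →L[ℝ] E →L[ℝ] ℝ) (fun x' ↦ metricCoords G x x') x := by
  have h := (mdifferentiableAt_section _ _).1 ((G.contMDiff x).mdifferentiableAt (by simp))
  refine h.congr_of_eventuallyEq ?_
  filter_upwards [(chartAt E x).open_source.mem_nhds (mem_chart_source E x)] with x' hx'
  ext v w
  simp [hom_trivializationAt_apply, ContinuousLinearMap.inCoordinates, metricCoords, ofCoords]
  have h' : x' ∈ (trivializationAt (E →L[ℝ] ℝ)
      (fun x ↦ TangentSpace 𝓘(ℝ, E) x →L[ℝ] ℝ) x).baseSet := by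
    simpa [hom_trivializationAt_baseSet] using hx'
  rw [Trivialization.coe_linearMapAt_of_mem _ h']
  simp [hom_trivializationAt_apply, ContinuousLinearMap.inCoordinates]

theorem hasFDerivAt_chart {F : Type*} [NormedAddCommGroup F] [NormedSpace ℝ F] {g : M → F} {x : M}
    (hg : MDifferentiableAt 𝓘(ℝ, E) 𝓘(ℝ, F) g x) :
    HasFDerivAt (g ∘ (extChartAt 𝓘(ℝ, E) x).symm) (mvfderiv 𝓘(ℝ, E) g x : E →L[ℝ] F)
      (extChartAt 𝓘(ℝ, E) x x) := by
  have := hg.hasMFDerivAt.2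
  rw [modelWithCornersSelf_coe, range_id] at this
  exact hasFDerivWithinAt_univ.1 this

theorem mvfderiv_congr {F : Type*} [NormedAddCommGroup F] [NormedSpace ℝ F] {g g' : M → F} {x : M}
    (h : g =ᶠ[𝓝 x] g') : mvfderiv 𝓘(ℝ, E) g x = mvfderiv 𝓘(ℝ, E) g' x := by
  ext v
  simp only [mvfderiv, h.mfderiv_eq]
  rfl

theorem mvfderiv_clm_apply {F₁ F₂ : Type*} [NormedAddCommGroup F₁] [NormedSpace ℝ F₁]
    [NormedAddCommGroup F₂] [NormedSpace ℝ F₂] {c : M → F₁ →L[ℝ] F₂} {u : M → F₁} {x : M}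
    (hc : MDifferentiableAt 𝓘(ℝ, E) 𝓘(ℝ, F₁ →L[ℝ] F₂) c x)
    (hu : MDifferentiableAt 𝓘(ℝ, E) 𝓘(ℝ, F₁) u x) (v : TangentSpace 𝓘(ℝ, E) x) :
    mvfderiv 𝓘(ℝ, E) (fun x' ↦ c x' (u x')) x v =
      mvfderiv 𝓘(ℝ, E) c x v (u x) + c x (mvfderiv 𝓘(ℝ, E) u x v) := by
  have h (p : E) (A : E →L[ℝ] F₁ →L[ℝ] F₂) (B D : E →L[ℝ] _) (c' : E → F₁ →L[ℝ] F₂) (u' : E → F₁)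
      (hA : HasFDerivAt c' A p) (hB : HasFDerivAt u' B p)
      (hD : HasFDerivAt (fun y ↦ c' y (u' y)) D p) (v : E) :
      D v = A v (u' p) + c' p (B v) := by
    rw [hD.unique (hA.clm_apply hB)]
    simp [add_comm]
  have := h _ _ _ _ _ _ (hasFDerivAt_chart hc) (hasFDerivAt_chart hu)
    (hasFDerivAt_chart (hc.clm_apply hu)) v
  simp only [Function.comp_apply, extChartAt_to_inv] at this
  exact this

/-- The derivatives `v(g_ij) w^i z^j` at `x` of the metric components in the preferred chart at `x`. -/
def metricDeriv (G : PseudoRiemannianMetric E M) (x : M) (v w z : TangentSpace 𝓘(ℝ, E) x) : ℝ :=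
  mvfderiv 𝓘(ℝ, E) (fun x' ↦ metricCoords G x x') x v (toCoords x x w) (toCoords x x z)

section
variable (G : PseudoRiemannianMetric E M) (x : M) (a b c d : TangentSpace 𝓘(ℝ, E) x) (r : ℝ)

theorem metricDeriv_add₁ :
    metricDeriv G x (a + b) c d = metricDeriv G x a c d + metricDeriv G x b c d := by
  simp only [metricDeriv]
  rw [ContinuousLinearMap.map_add]; rfl

theorem metricDeriv_smul₁ : metricDeriv G x (r • a) c d = r * metricDeriv G x a c d := by
  simp only [metricDeriv]
  rw [ContinuousLinearMap.map_smul]; rfl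

theorem metricDeriv_add₂ :
    metricDeriv G x c (a + b) d = metricDeriv G x c a d + metricDeriv G x c b d := by
  simp [metricDeriv]

theorem metricDeriv_smul₂ : metricDeriv G x c (r • a) d = r * metricDeriv G x c a d := by
  simp [metricDeriv]

theorem metricDeriv_add₃ :
    metricDeriv G x c d (a + b) = metricDeriv G x c d a + metricDeriv G x c d b := by
  simp [metricDeriv]

theorem metricDeriv_smul₃ : metricDeriv G x c d (r • a) = r * metricDeriv G x c d a := by
  simp [metricDeriv]

end

theorem metricDeriv_eq (G : PseudoRiemannianMetric E M) (x : M)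
    (v w z : TangentSpace 𝓘(ℝ, E) x) : metricDeriv G x v w z =
      mvfderiv 𝓘(ℝ, E) (fun x' ↦ metricCoords G x x' (toCoords x x w) (toCoords x x z)) x v := by
  rw [mvfderiv_clm_apply ((mdifferentiableAt_metricCoords G x).clm_apply mdifferentiableAt_const)
    mdifferentiableAt_const, mvfderiv_clm_apply (mdifferentiableAt_metricCoords G x)
    mdifferentiableAt_const, mvfderiv_const, mvfderiv_const]
  simp [metricDeriv]

theorem metricDeriv_symm (G : PseudoRiemannianMetric E M) (x : M)
    (v w z : TangentSpace 𝓘(ℝ, E) x) : metricDeriv G x v w z = metricDeriv G x v z w := by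
  rw [metricDeriv_eq, metricDeriv_eq]
  congr 2
  ext x'
  exact G.symm _ _ _

theorem extend_eq_ofCoords {x x' : M} (hx' : x' ∈ (chartAt E x).source)
    (w : TangentSpace 𝓘(ℝ, E) x) :
    FiberBundle.extend E w x' = ofCoords x x' (toCoords x x w) := by
  have hx : x' ∈ (trivializationAt E (TangentSpace 𝓘(ℝ, E)) x).baseSet := hx'
  have h0 : x ∈ (trivializationAt E (TangentSpace 𝓘(ℝ, E)) x).baseSet := mem_chart_source E x
  simp only [FiberBundle.extend, ofCoords, toCoords, Trivialization.symmL_apply _ hx,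
    Trivialization.continuousLinearMapAt_apply, Trivialization.coe_linearMapAt_of_mem _ h0]

theorem coordDerivative_extend {x : M} (w : TangentSpace 𝓘(ℝ, E) x) :
    coordDerivative (FiberBundle.extend E w) x = 0 := by
  have : (fun x' ↦ toCoords x x' (FiberBundle.extend E w x')) =ᶠ[𝓝 x] fun _ ↦ toCoords x x w := by
    filter_upwards [(chartAt E x).open_source.mem_nhds (mem_chart_source E x)] with x' hx'
    rw [extend_eq_ofCoords hx', toCoords_ofCoords x x' hx']
  change ofCoords x x ∘L mvfderiv 𝓘(ℝ, E) (fun x' ↦ toCoords x x' _) x = 0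
  rw [mvfderiv_congr this, mvfderiv_const, ContinuousLinearMap.comp_zero]

theorem mpullbackWithin_extend {x : M} (w : TangentSpace 𝓘(ℝ, E) x) :
    VectorField.mpullbackWithin 𝓘(ℝ, E) 𝓘(ℝ, E) (extChartAt 𝓘(ℝ, E) x).symm
      (FiberBundle.extend E w) (range 𝓘(ℝ, E)) =ᶠ[𝓝 (extChartAt 𝓘(ℝ, E) x x)]
      fun _ ↦ toCoords x x w := by
  filter_upwards [extChartAt_target_mem_nhds (I := 𝓘(ℝ, E)) x] with y hy
  set x' := (extChartAt 𝓘(ℝ, E) x).symm y with hx'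
  have hs : x' ∈ (chartAt E x).source := by
    have := (extChartAt 𝓘(ℝ, E) x).map_target hy
    rwa [extChartAt_source] at this
  have hm : mfderivWithin 𝓘(ℝ, E) 𝓘(ℝ, E) (extChartAt 𝓘(ℝ, E) x).symm (range 𝓘(ℝ, E)) y =
      (ofCoords x x' : E →L[ℝ] TangentSpace 𝓘(ℝ, E) x') := by
    have h := TangentBundle.symmL_trivializationAt (I := 𝓘(ℝ, E)) hs
    rw [hx', (extChartAt 𝓘(ℝ, E) x).right_inv hy] at h
    exact h.symm
  rw [VectorField.mpullbackWithin_apply, extend_eq_ofCoords hs, hm]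
  have hi : (ofCoords x x').IsInvertible :=
    ⟨ContinuousLinearEquiv.equivOfInverse (ofCoords x x') (toCoords x x')
      (toCoords_ofCoords x x' hs) (ofCoords_toCoords x x' hs), rfl⟩
  exact hi.inverse_apply_self (toCoords x x w)

variable [FiniteDimensional ℝ E]

/-- The Christoffel symbols of the first kind at `x`, in the preferred chart at `x`:
`z ↦ (v(g)(w, z) + w(g)(v, z) - z(g)(v, w)) / 2`. -/
def christoffelFirst (G : PseudoRiemannianMetric E M) (x : M) (v w : TangentSpace 𝓘(ℝ, E) x) :
    TangentSpace 𝓘(ℝ, E) x →L[ℝ] ℝ :=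
  LinearMap.toContinuousLinearMap
    { toFun := fun z ↦ 1 / 2 * (metricDeriv G x v w z + metricDeriv G x w v z
        - metricDeriv G x z v w)
      map_add' := fun a b ↦ by rw [metricDeriv_add₁, metricDeriv_add₃, metricDeriv_add₃]; ring
      map_smul' := fun a b ↦ by
        rw [metricDeriv_smul₁, metricDeriv_smul₃, metricDeriv_smul₃, RingHom.id_apply, smul_eq_mul]
        ring }

theorem christoffelFirst_apply (G : PseudoRiemannianMetric E M) (x : M)
    (v w z : TangentSpace 𝓘(ℝ, E) x) :
    christoffelFirst G x v w z = 1 / 2 * (metricDeriv G x v w z + metricDeriv G x w v z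
        - metricDeriv G x z v w) := rfl

/-- The Christoffel symbols `Γ(w)(v) = Γ^k_ij v^i w^j ∂_k` at `x`, in the preferred chart at `x`. -/
def christoffel (G : PseudoRiemannianMetric E M) (x : M) :
    TangentSpace 𝓘(ℝ, E) x →L[ℝ] TangentSpace 𝓘(ℝ, E) x →L[ℝ] TangentSpace 𝓘(ℝ, E) x :=
  LinearMap.toContinuousBilinearMap <|
    LinearMap.mk₂ ℝ (fun w v ↦ (G.val x).inverse (christoffelFirst G x v w))
      (fun a b c ↦ by
        rw [← map_add]; congr 1; ext z
        simp only [_root_.add_apply, christoffelFirst_apply, metricDeriv_add₁,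
          metricDeriv_add₂, metricDeriv_add₃]
        ring)
      (fun r a b ↦ by
        rw [← map_smul]; congr 1; ext z
        simp only [_root_.smul_apply, christoffelFirst_apply, metricDeriv_smul₁,
          metricDeriv_smul₂, metricDeriv_smul₃, smul_eq_mul]
        ring)
      (fun a b c ↦ by
        rw [← map_add]; congr 1; ext z
        simp only [_root_.add_apply, christoffelFirst_apply, metricDeriv_add₁,
          metricDeriv_add₂]
        ring)
      (fun r a b ↦ by
        rw [← map_smul]; congr 1; ext z
        simp only [_root_.smul_apply, christoffelFirst_apply, metricDeriv_smul₁,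
          metricDeriv_smul₂, smul_eq_mul]
        ring)

/-- The Levi-Civita connection: in coordinates `(∇_v σ)^k = v(σ^k) + Γ^k_ij v^i σ^j`. It is torsion-free
and metric, see `leviCivita_torsion` and `leviCivita_metric`. -/
def leviCivita (G : PseudoRiemannianMetric E M) :
    CovariantDerivative 𝓘(ℝ, E) E (TangentSpace 𝓘(ℝ, E) : M → Type _) :=
  coordDerivative.addOneForm (christoffel G)

theorem leviCivita_apply (G : PseudoRiemannianMetric E M)
    (σ : ∀ x : M, TangentSpace 𝓘(ℝ, E) x) (x : M) :
    leviCivita G σ x = coordDerivative σ x + christoffel G x (σ x) := rfl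

theorem metric_isInvertible (G : PseudoRiemannianMetric E M) (x : M) :
    (G.val x).IsInvertible := by
  have hinj : Function.Injective (G.val x).toLinearMap := by
    rw [injective_iff_map_eq_zero]
    intro v hv
    refine G.nondegenerate x v fun w ↦ ?_
    have : G.val x v = 0 := hv
    rw [this]; rfl
  have hdim : Module.finrank ℝ (TangentSpace 𝓘(ℝ, E) x) =
      Module.finrank ℝ (TangentSpace 𝓘(ℝ, E) x →L[ℝ] ℝ) := by
    rw [← (LinearMap.toContinuousLinearMap (𝕜 := ℝ) (E := TangentSpace 𝓘(ℝ, E) x)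
      (F' := ℝ)).finrank_eq]
    exact Subspace.dual_finrank_eq.symm
  have : FiniteDimensional ℝ (TangentSpace 𝓘(ℝ, E) x →L[ℝ] ℝ) :=
    Module.Finite.equiv (LinearMap.toContinuousLinearMap (𝕜 := ℝ) (E := TangentSpace 𝓘(ℝ, E) x)
      (F' := ℝ))
  refine ⟨(LinearEquiv.ofInjectiveOfFinrankEq _ hinj hdim).toContinuousLinearEquiv, ?_⟩
  ext v w
  rfl

theorem metric_christoffel (G : PseudoRiemannianMetric E M) (x : M)
    (v w z : TangentSpace 𝓘(ℝ, E) x) :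
    G.val x (christoffel G x w v) z = christoffelFirst G x v w z := by
  change G.val x ((G.val x).inverse (christoffelFirst G x v w)) z = _
  rw [(metric_isInvertible G x).self_apply_inverse]

theorem christoffel_symm (G : PseudoRiemannianMetric E M) (x : M)
    (v w : TangentSpace 𝓘(ℝ, E) x) : christoffel G x w v = christoffel G x v w := by
  change (G.val x).inverse (christoffelFirst G x v w) =
    (G.val x).inverse (christoffelFirst G x w v)
  congr 1
  ext z
  rw [christoffelFirst_apply, christoffelFirst_apply, metricDeriv_symm G x z v w]
  ring

theorem coordDerivative_torsion : (coordDerivative (E := E) (M := M)).torsion = 0 := by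
  ext x u v
  rw [CovariantDerivative.torsion_apply_eq_extend, coordDerivative_extend, coordDerivative_extend]
  rw [← VectorField.mlieBracketWithin_univ, VectorField.mlieBracketWithin_apply]
  have h0 (V W : E → E) (a b : E) (s : Set E) (p : E) (hV : V =ᶠ[𝓝 p] fun _ ↦ a)
      (hW : W =ᶠ[𝓝 p] fun _ ↦ b) : VectorField.lieBracketWithin ℝ V W s p = 0 := by
    have h1 := (hV.filter_mono nhdsWithin_le_nhds : V =ᶠ[𝓝[s] p] _).fderivWithin_eq (𝕜 := ℝ)
      hV.eq_of_nhds
    have h2 := (hW.filter_mono nhdsWithin_le_nhds : W =ᶠ[𝓝[s] p] _).fderivWithin_eq (𝕜 := ℝ)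
      hW.eq_of_nhds
    simp [VectorField.lieBracketWithin, h1, h2]
  have h1 := h0 _ _ _ _ ((extChartAt 𝓘(ℝ, E) x).symm ⁻¹' univ ∩ range 𝓘(ℝ, E)) _
    (mpullbackWithin_extend u) (mpullbackWithin_extend v)
  refine Eq.trans (congrArg _ (congrArg _ h1)) ?_
  erw [map_zero]
  simp

theorem leviCivita_torsion (G : PseudoRiemannianMetric E M) : (leviCivita G).torsion = 0 := by
  rw [CovariantDerivative.torsion_eq_zero_iff]
  intro X Y x hX hY
  rw [← (CovariantDerivative.torsion_eq_zero_iff _).1 coordDerivative_torsion hX hY]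
  simp only [leviCivita_apply, _root_.add_apply]
  rw [christoffel_symm]
  abel

/-- The Levi-Civita connection is metric. -/
theorem leviCivita_metric (G : PseudoRiemannianMetric E M) {x : M}
    {σ τ : ∀ x : M, TangentSpace 𝓘(ℝ, E) x}
    (hσ : MDifferentiableAt 𝓘(ℝ, E) 𝓘(ℝ, E).tangent
      (fun x' ↦ (TotalSpace.mk' E x' (σ x') : TangentBundle 𝓘(ℝ, E) M)) x)
    (hτ : MDifferentiableAt 𝓘(ℝ, E) 𝓘(ℝ, E).tangent
      (fun x' ↦ (TotalSpace.mk' E x' (τ x') : TangentBundle 𝓘(ℝ, E) M)) x)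
    (v : TangentSpace 𝓘(ℝ, E) x) :
    mvfderiv 𝓘(ℝ, E) (fun x' ↦ G.val x' (σ x') (τ x')) x v =
      G.val x (leviCivita G σ x v) (τ x) + G.val x (σ x) (leviCivita G τ x v) := by
  have h : mvfderiv 𝓘(ℝ, E) (fun x' ↦ G.val x' (σ x') (τ x')) x v =
      metricDeriv G x v (σ x) (τ x) + G.val x (coordDerivative σ x v) (τ x)
       + G.val x (σ x) (coordDerivative τ x v) := by
    have h5 : (fun x' ↦ G.val x' (σ x') (τ x')) =ᶠ[𝓝 x]
        (fun x' ↦ metricCoords G x x' (toCoords x x' (σ x')) (toCoords x x' (τ x'))) := by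
      filter_upwards [(chartAt E x).open_source.mem_nhds (mem_chart_source E x)] with x' hx'
      change _ = G.val x' (ofCoords x x' (toCoords x x' _)) (ofCoords x x' (toCoords x x' _))
      rw [ofCoords_toCoords x x' hx', ofCoords_toCoords x x' hx']
    rw [mvfderiv_congr h5, mvfderiv_clm_apply ((mdifferentiableAt_metricCoords G x).clm_apply
      (mdifferentiableAt_toCoords hσ)) (mdifferentiableAt_toCoords hτ),
      mvfderiv_clm_apply (mdifferentiableAt_metricCoords G x) (mdifferentiableAt_toCoords hσ)]
    change metricDeriv G x v (σ x) (τ x) +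
      G.val x (coordDerivative σ x v) (ofCoords x x (toCoords x x (τ x))) +
      G.val x (ofCoords x x (toCoords x x (σ x))) (coordDerivative τ x v) = _
    rw [ofCoords_toCoords x x (mem_chart_source E x), ofCoords_toCoords x x (mem_chart_source E x)]
  rw [h]
  simp only [leviCivita_apply, _root_.add_apply, map_add]
  rw [G.symm x (σ x) (christoffel G x (τ x) v), metric_christoffel, metric_christoffel,
    christoffelFirst_apply, christoffelFirst_apply, metricDeriv_symm G x v (τ x),
    metricDeriv_symm G x (τ x), metricDeriv_symm G x (σ x)]
  ring

/-- The pullback `e^*∇` of a connection `∇` on `TM` along a map `e : Y → M`, acting on sections `s`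
of `e^*TM`: writing `s = ∑ sⁱ (∂ᵢ ∘ e)` in the coordinate frame `∂ᵢ` of the preferred chart at
`e y`, it is `(e^*∇)_u s = ∑ u(sⁱ) ∂ᵢ + ∑ sⁱ ∇_{de u} ∂ᵢ` at `y`.
As for Mathlib's covariant derivatives, `pullbackDeriv cov e s y u` is `(e^*∇)_u s` at `y`. -/
def pullbackDeriv (cov : CovariantDerivative 𝓘(ℝ, E) E (TangentSpace 𝓘(ℝ, E) : M → Type _))
    (e : Y → M) (s : ∀ y : Y, TangentSpace 𝓘(ℝ, E) (e y)) (y : Y) :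
    TangentSpace 𝓘(ℝ, E') y →L[ℝ] TangentSpace 𝓘(ℝ, E) (e y) :=
  ofCoords (e y) (e y) ∘L mvfderiv 𝓘(ℝ, E') (fun y' ↦ toCoords (e y) (e y') (s y')) y +
    cov (FiberBundle.extend E (s y)) (e y) ∘L mfderiv 𝓘(ℝ, E') 𝓘(ℝ, E) e y

theorem cov_extend_eq (cov : CovariantDerivative 𝓘(ℝ, E) E (TangentSpace 𝓘(ℝ, E) : M → Type _))
    {x : M} (w : TangentSpace 𝓘(ℝ, E) x) :
    cov (FiberBundle.extend E w) x = cov.difference coordDerivative x w := by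
  have h : cov.difference coordDerivative x (FiberBundle.extend E w x) =
      cov (FiberBundle.extend E w) x - coordDerivative (FiberBundle.extend E w) x :=
    IsCovariantDerivativeOn.difference_apply _ _ (by trivial)
      (FiberBundle.mdifferentiableAt_extend 𝓘(ℝ, E) E w)
  rw [FiberBundle.extend_apply_self, coordDerivative_extend, sub_zero] at h
  exact h.symm

theorem cov_eq_extend (cov : CovariantDerivative 𝓘(ℝ, E) E (TangentSpace 𝓘(ℝ, E) : M → Type _))
    {x : M} {σ : ∀ x : M, TangentSpace 𝓘(ℝ, E) x}
    (hσ : MDifferentiableAt 𝓘(ℝ, E) 𝓘(ℝ, E).tangent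
      (fun x' ↦ (TotalSpace.mk' E x' (σ x') : TangentBundle 𝓘(ℝ, E) M)) x) :
    cov σ x = coordDerivative σ x + cov (FiberBundle.extend E (σ x)) x := by
  have h1 : cov.difference coordDerivative x (σ x) = cov σ x - coordDerivative σ x :=
    IsCovariantDerivativeOn.difference_apply _ _ (by trivial) hσ
  rw [cov_extend_eq, h1]
  abel

/-- Characteristic property of the pullback connection: `(e^*∇)_u (σ ∘ e) = ∇_{de u} σ`. -/
theorem pullbackDeriv_comp
    (cov : CovariantDerivative 𝓘(ℝ, E) E (TangentSpace 𝓘(ℝ, E) : M → Type _))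
    {e : Y → M} {y : Y} (he : MDifferentiableAt 𝓘(ℝ, E') 𝓘(ℝ, E) e y)
    {σ : ∀ x : M, TangentSpace 𝓘(ℝ, E) x}
    (hσ : MDifferentiableAt 𝓘(ℝ, E) 𝓘(ℝ, E).tangent
      (fun x' ↦ (TotalSpace.mk' E x' (σ x') : TangentBundle 𝓘(ℝ, E) M)) (e y)) :
    pullbackDeriv cov e (fun y' ↦ σ (e y')) y =
      cov σ (e y) ∘L mfderiv 𝓘(ℝ, E') 𝓘(ℝ, E) e y := by
  have hc : MDifferentiableAt 𝓘(ℝ, E) 𝓘(ℝ, E) (fun x' ↦ toCoords (e y) x' (σ x')) (e y) :=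
    mdifferentiableAt_toCoords hσ
  have h : mvfderiv 𝓘(ℝ, E') ((fun x' ↦ toCoords (e y) x' (σ x')) ∘ e) y =
      (mvfderiv 𝓘(ℝ, E) (fun x' ↦ toCoords (e y) x' (σ x')) (e y)).comp
        (mfderiv 𝓘(ℝ, E') 𝓘(ℝ, E) e y) := mfderiv_comp y hc he
  rw [cov_eq_extend cov hσ, pullbackDeriv, ContinuousLinearMap.add_comp]
  congr 1
  change _ ∘L mvfderiv 𝓘(ℝ, E') ((fun x' ↦ toCoords (e y) x' (σ x')) ∘ e) y = _
  rw [h]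
  rfl

section PullbackAlgebra

variable (cov : CovariantDerivative 𝓘(ℝ, E) E (TangentSpace 𝓘(ℝ, E) : M → Type _))
  {e : Y → M} {y : Y} {s t : ∀ y : Y, TangentSpace 𝓘(ℝ, E) (e y)}

theorem mdifferentiableAt_toCoords_along
    (hs : MDifferentiableAt 𝓘(ℝ, E') 𝓘(ℝ, E).tangent
      (fun y' ↦ (TotalSpace.mk' E (e y') (s y') : TangentBundle 𝓘(ℝ, E) M)) y) :
    MDifferentiableAt 𝓘(ℝ, E') 𝓘(ℝ, E) (fun y' ↦ toCoords (e y) (e y') (s y')) y := by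
  have h := (mdifferentiableAt_totalSpace _ _).1 hs
  refine h.2.congr_of_eventuallyEq ?_
  filter_upwards [h.1.continuousAt
    ((chartAt E (e y)).open_source.mem_nhds (mem_chart_source E (e y)))] with y' hy'
  have hb : e y' ∈ (trivializationAt E (TangentSpace 𝓘(ℝ, E)) (e y)).baseSet := hy'
  simp only [toCoords, Trivialization.continuousLinearMapAt_apply,
    Trivialization.coe_linearMapAt_of_mem _ hb]

theorem cov_extend_add {x : M} (a b : TangentSpace 𝓘(ℝ, E) x) :
    cov (FiberBundle.extend E (a + b)) x =
      cov (FiberBundle.extend E a) x + cov (FiberBundle.extend E b) x := by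
  rw [cov_extend_eq, cov_extend_eq, cov_extend_eq, map_add]

theorem cov_extend_smul {x : M} (r : ℝ) (a : TangentSpace 𝓘(ℝ, E) x) :
    cov (FiberBundle.extend E (r • a)) x = r • cov (FiberBundle.extend E a) x := by
  rw [cov_extend_eq, cov_extend_eq, map_smul]

theorem pullbackDeriv_add
    (hs : MDifferentiableAt 𝓘(ℝ, E') 𝓘(ℝ, E).tangent
      (fun y' ↦ (TotalSpace.mk' E (e y') (s y') : TangentBundle 𝓘(ℝ, E) M)) y)
    (ht : MDifferentiableAt 𝓘(ℝ, E') 𝓘(ℝ, E).tangent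
      (fun y' ↦ (TotalSpace.mk' E (e y') (t y') : TangentBundle 𝓘(ℝ, E) M)) y) :
    pullbackDeriv (E' := E') cov e (fun y' ↦ s y' + t y') y =
      pullbackDeriv cov e s y + pullbackDeriv cov e t y := by
  have h1 : MDifferentiableAt 𝓘(ℝ, E') 𝓘(ℝ, E) (fun y' ↦ toCoords (e y) (e y') (s y')) y :=
    mdifferentiableAt_toCoords_along (E' := E') (e := e) (s := s) hs
  have h2 : MDifferentiableAt 𝓘(ℝ, E') 𝓘(ℝ, E) (fun y' ↦ toCoords (e y) (e y') (t y')) y :=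
    mdifferentiableAt_toCoords_along (E' := E') (e := e) (s := t) ht
  have := mvfderiv_fun_add h1 h2
  simp only [pullbackDeriv, map_add]
  rw [this, cov_extend_add, ContinuousLinearMap.comp_add, ContinuousLinearMap.add_comp]
  abel

theorem pullbackDeriv_smul {g : Y → ℝ} (hg : MDifferentiableAt 𝓘(ℝ, E') 𝓘(ℝ) g y)
    (hs : MDifferentiableAt 𝓘(ℝ, E') 𝓘(ℝ, E).tangent
      (fun y' ↦ (TotalSpace.mk' E (e y') (s y') : TangentBundle 𝓘(ℝ, E) M)) y) :
    pullbackDeriv cov e (fun y' ↦ g y' • s y') y =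
      g y • pullbackDeriv cov e s y + (mvfderiv 𝓘(ℝ, E') g y).smulRight (s y) := by
  have h1 : MDifferentiableAt 𝓘(ℝ, E') 𝓘(ℝ, E) (fun y' ↦ toCoords (e y) (e y') (s y')) y :=
    mdifferentiableAt_toCoords_along (E' := E') (e := e) (s := s) hs
  have := mvfderiv_fun_smul hg h1
  simp only [pullbackDeriv, map_smul]
  rw [this, cov_extend_smul]
  ext v
  simp [ofCoords_toCoords (e y) (e y) (mem_chart_source E (e y))]
  abel

end PullbackAlgebra

/-- A smooth differential 2-form on `Y`. -/
structure TwoForm (E' : Type*) [NormedAddCommGroup E'] [NormedSpace ℝ E']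
    (Y : Type*) [TopologicalSpace Y] [ChartedSpace E' Y] [IsManifold 𝓘(ℝ, E') ∞ Y] where
  val (y : Y) : TangentSpace 𝓘(ℝ, E') y →L[ℝ] TangentSpace 𝓘(ℝ, E') y →L[ℝ] ℝ
  alternating (y : Y) (v : TangentSpace 𝓘(ℝ, E') y) : val y v v = 0
  contMDiff : ContMDiff 𝓘(ℝ, E') (𝓘(ℝ, E').prod 𝓘(ℝ, E' →L[ℝ] E' →L[ℝ] ℝ)) ∞
    (fun y ↦ TotalSpace.mk' (E' →L[ℝ] E' →L[ℝ] ℝ) y (val y))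

/-- The value `dF(u, v, w)` at `y` of the exterior derivative of a 2-form on vector fields that are
smooth near `y`; it depends only on the values of `u`, `v`, `w` at `y`. -/
def TwoForm.extDeriv (F : TwoForm E' Y) (u v w : ∀ y : Y, TangentSpace 𝓘(ℝ, E') y) (y : Y) : ℝ :=
  mvfderiv 𝓘(ℝ, E') (fun y' ↦ F.val y' (v y') (w y')) y (u y)
    - mvfderiv 𝓘(ℝ, E') (fun y' ↦ F.val y' (u y') (w y')) y (v y)
    + mvfderiv 𝓘(ℝ, E') (fun y' ↦ F.val y' (u y') (v y')) y (w y)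
    - F.val y (VectorField.mlieBracket 𝓘(ℝ, E') u v y) (w y)
    + F.val y (VectorField.mlieBracket 𝓘(ℝ, E') u w y) (v y)
    - F.val y (VectorField.mlieBracket 𝓘(ℝ, E') v w y) (u y)

/-- Smoothness of a vector field near `y`. -/
def SmoothFieldAt (u : ∀ y : Y, TangentSpace 𝓘(ℝ, E') y) (y : Y) : Prop :=
  ContMDiffAt 𝓘(ℝ, E') 𝓘(ℝ, E').tangent ∞
    (fun y' ↦ (TotalSpace.mk' E' y' (u y') : TangentBundle 𝓘(ℝ, E') Y)) y

/-- `dF = 0`. -/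
def TwoForm.IsClosed (F : TwoForm E' Y) : Prop :=
  ∀ (y : Y) (u v w : ∀ y : Y, TangentSpace 𝓘(ℝ, E') y),
    SmoothFieldAt u y → SmoothFieldAt v y → SmoothFieldAt w y → F.extDeriv u v w y = 0

/-- The topological bibrane condition on `(Y, F)`: whenever `u ∈ TY` and `v ∈ e^*TM` satisfy
`G(v, w) = F(u, w)` for all `w ∈ TY`, then `v ∈ TY` and `G(u, w) = F(v, w)` for all `w ∈ TY`. -/
def IsTopologicalBibrane (G : PseudoRiemannianMetric E M) (e : Y → M) (F : TwoForm E' Y) : Prop :=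
  ∀ (y : Y) (u : TangentSpace 𝓘(ℝ, E') y) (v : TangentSpace 𝓘(ℝ, E) (e y)),
    (∀ w : TangentSpace 𝓘(ℝ, E') y,
      G.val (e y) v (mfderiv 𝓘(ℝ, E') 𝓘(ℝ, E) e y w) = F.val y u w) →
    ∃ v' : TangentSpace 𝓘(ℝ, E') y, mfderiv 𝓘(ℝ, E') 𝓘(ℝ, E) e y v' = v ∧
      ∀ w : TangentSpace 𝓘(ℝ, E') y,
        G.val (e y) (mfderiv 𝓘(ℝ, E') 𝓘(ℝ, E) e y u) (mfderiv 𝓘(ℝ, E') 𝓘(ℝ, E) e y w) =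
          F.val y v' w

/-- The distribution `R₊ = {u ∈ TY : G(u, w) = F(u, w) for all w ∈ TY}`. -/
def rPlus (G : PseudoRiemannianMetric E M) (e : Y → M) (F : TwoForm E' Y) (y : Y) :
    Submodule ℝ (TangentSpace 𝓘(ℝ, E') y) where
  carrier := {u | ∀ w : TangentSpace 𝓘(ℝ, E') y,
    G.val (e y) (mfderiv 𝓘(ℝ, E') 𝓘(ℝ, E) e y u) (mfderiv 𝓘(ℝ, E') 𝓘(ℝ, E) e y w) = F.val y u w}
  zero_mem' := by intro w; simp
  add_mem' := by intro a b ha hb w; simp [ha w, hb w]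
  smul_mem' := by intro c a ha w; simp [ha w]

/-- A distribution `D` on `Y` is integrable if through every point `p` passes an integral manifold
of `D`, here given by a (local) parametrization `j : U → Y`: an immersion of an open neighbourhood
`U` of `0` in some `ℝ^r` with `j 0 = p` and with tangent space `D` at each of its points. -/
def IsIntegrable (D : ∀ y : Y, Submodule ℝ (TangentSpace 𝓘(ℝ, E') y)) : Prop :=
  ∀ p : Y, ∃ (r : ℕ) (U : Set (EuclideanSpace ℝ (Fin r))) (j : EuclideanSpace ℝ (Fin r) → Y),
    IsOpen U ∧ 0 ∈ U ∧ j 0 = p ∧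
    ContMDiffOn 𝓘(ℝ, EuclideanSpace ℝ (Fin r)) 𝓘(ℝ, E') ∞ j U ∧
    ∀ x ∈ U,
      Function.Injective (mfderiv 𝓘(ℝ, EuclideanSpace ℝ (Fin r)) 𝓘(ℝ, E') j x) ∧
      LinearMap.range (mfderiv 𝓘(ℝ, EuclideanSpace ℝ (Fin r)) 𝓘(ℝ, E') j x).toLinearMap = D (j x)

/-- Smooth sections of a distribution `D ⊆ TY`. -/
def IsSmoothSectionOf (D : ∀ y : Y, Submodule ℝ (TangentSpace 𝓘(ℝ, E') y))
    (s : ∀ y : Y, TangentSpace 𝓘(ℝ, E') y) : Prop :=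
  ContMDiff 𝓘(ℝ, E') 𝓘(ℝ, E').tangent ∞
    (fun y ↦ (TotalSpace.mk' E' y (s y) : TangentBundle 𝓘(ℝ, E') Y)) ∧ ∀ y, s y ∈ D y

end Bibrane

end

/-! The proof separates an analytic part from a linear algebra part. Let `H = e^*G - F`, a bilinear
form on `TY` that is neither symmetric nor alternating; `R₊` is its left kernel. The analytic part
shows that `∇_u s` is `G`-orthogonal to `R₊`; the linear algebra part shows that a vector orthogonal
to `R₊` lies in `R₊`. The bibrane condition enters only in the second part.

Work in charts, write `h = e^*G` and let `D` be the coordinate derivative. Three identities hold at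
a point, for `t` in `R₊`. Differentiating `H(s, t) = 0` along `u` with `t` constant gives `(D_u
H)(s, t) + H(D_u s, t) = 0`, where `H(D_u s, t) = 2 h(D_u s, t)` because `F(t, ·) = h(t, ·)` and `F`
is alternating. On an integral manifold `H` kills tangent vectors, so symmetry of second derivatives
gives `(D_t H)(s, u) = (D_s H)(t, u)` (`fderiv_form_symm_of_integral`). Closedness gives `D_u F(s,
t) = D_t F(s, u) - D_s F(t, u)`. Eliminating `F` turns the first identity into `2 h(D_u s, t) + D_u
h(s, t) + D_s h(t, u) - D_t h(s, u) = 0`. This is the Koszul expression for `2 G(∇_u s, t)`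
(`metric_covariant_eq_zero`, transferred to the manifold in `metric_pullbackDeriv_eq_zero`).

For the second part (`exists_of_orthogonal`), the bibrane condition puts `(TY)^⊥` inside `R₊`, so a
vector orthogonal to `R₊` is tangent to `Y`. It also pairs each `w` in `TY` with some `b` such that
`w + b` lies in `R₊`; testing orthogonality on these sums gives membership in `R₊`. -/

namespace Bibrane

/-! ### The differential identity in a vector space. -/

section Calculus

set_option maxSynthPendingDepth 3

variable {E E' V : Type*} [NormedAddCommGroup E] [NormedSpace ℝ E]
  [NormedAddCommGroup E'] [NormedSpace ℝ E'] [NormedAddCommGroup V] [NormedSpace ℝ V]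

/-- The derivative of a bilinear form is symmetric on the tangent space of a submanifold on which
the form vanishes identically. -/
theorem fderiv_form_symm_of_integral {H : E' → E' →L[ℝ] E' →L[ℝ] ℝ}
    {DH : E' →L[ℝ] E' →L[ℝ] E' →L[ℝ] ℝ} {γ : V → E'} {q : V}
    (hH : HasFDerivAt H DH (γ q)) (hγ : ContDiffAt ℝ 2 γ q)
    (hker : ∀ᶠ x in 𝓝 q, ∀ a w, H (γ x) (fderiv ℝ γ x a) w = 0) (a b : V) :
    DH (fderiv ℝ γ q a) (fderiv ℝ γ q b) = DH (fderiv ℝ γ q b) (fderiv ℝ γ q a) := by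
  have hd : HasFDerivAt γ (fderiv ℝ γ q) q := (hγ.differentiableAt (by simp)).hasFDerivAt
  have hdd : HasFDerivAt (fderiv ℝ γ) (fderiv ℝ (fderiv ℝ γ) q) q :=
    ((hγ.fderiv_right (m := 1) (by norm_num)).differentiableAt (by simp)).hasFDerivAt
  -- Differentiate `H (γ x) (γ' x d) = 0` at `q` in the direction `c`. The remaining term depends on
  -- `c`, `d` only through the second derivative of `γ`, which is symmetric.
  have key (c d : V) : DH (fderiv ℝ γ q c) (fderiv ℝ γ q d) =
      - H (γ q) (fderiv ℝ (fderiv ℝ γ) q c d) := by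
    have h0 : HasFDerivAt (fun x ↦ H (γ x)) (DH ∘L fderiv ℝ γ q) q := hH.comp q hd
    have h1 := h0.clm_apply (hdd.clm_apply (hasFDerivAt_const d q))
    have h2 : (fun x ↦ H (γ x) (fderiv ℝ γ x d)) =ᶠ[𝓝 q] fun _ ↦ 0 := by
      filter_upwards [hker] with x hx
      ext w
      exact hx d w
    have h3 := congrArg (fun A ↦ A c)
      (h1.unique ((hasFDerivAt_const (0 : E' →L[ℝ] ℝ) q).congr_of_eventuallyEq h2))
    rw [eq_neg_iff_add_eq_zero, add_comm]
    simpa using h3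
  have hs : IsSymmSndFDerivAt ℝ γ q := hγ.isSymmSndFDerivAt (by simp)
  rw [key, key, hs.eq]

theorem hasFDerivAt_form_apply {f : E → E' →L[ℝ] E' →L[ℝ] ℝ}
    {Df : E →L[ℝ] E' →L[ℝ] E' →L[ℝ] ℝ} {p : E} (hf : HasFDerivAt f Df p) (a b : E') :
    ∃ D : E →L[ℝ] ℝ, HasFDerivAt (fun z ↦ f z a b) D p ∧ ∀ v, D v = Df v a b := by
  have h := (hf.clm_apply (hasFDerivAt_const a p)).clm_apply (hasFDerivAt_const b p)
  exact ⟨_, h, fun v ↦ by simp⟩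

/-- The pullback `g(e z)(J z ·, J z ·)` of a bilinear form. -/
noncomputable def pullForm (g : E → E →L[ℝ] E →L[ℝ] ℝ) (e : E' → E) (J : E' → E' →L[ℝ] E)
    (z : E') : E' →L[ℝ] E' →L[ℝ] ℝ :=
  (ContinuousLinearMap.compL ℝ E' E ℝ).flip (J z) ∘L (g (e z) ∘L J z)

theorem pullForm_apply (g : E → E →L[ℝ] E →L[ℝ] ℝ) (e : E' → E) (J : E' → E' →L[ℝ] E)
    (z a b : E') : pullForm g e J z a b = g (e z) (J z a) (J z b) := rfl

/-- Product and chain rule. The `D2` terms, second derivatives of the embedding, supply the part of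
`∇_u s` that comes from differentiating `J`. -/
theorem hasFDerivAt_pullForm {g : E → E →L[ℝ] E →L[ℝ] ℝ} {e : E' → E} {J : E' → E' →L[ℝ] E}
    {p : E'} {Dg : E →L[ℝ] E →L[ℝ] E →L[ℝ] ℝ} {D2 : E' →L[ℝ] E' →L[ℝ] E}
    (hg : HasFDerivAt g Dg (e p)) (he : HasFDerivAt e (J p) p) (hJ : HasFDerivAt J D2 p) :
    ∃ DH : E' →L[ℝ] E' →L[ℝ] E' →L[ℝ] ℝ, HasFDerivAt (pullForm g e J) DH p ∧ ∀ a b c, DH a b c =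
      Dg (J p a) (J p b) (J p c) + g (e p) (D2 a b) (J p c) + g (e p) (J p b) (D2 a c) := by
  let P : (E' →L[ℝ] E) →L[ℝ] (E →L[ℝ] ℝ) →L[ℝ] E' →L[ℝ] ℝ :=
    (ContinuousLinearMap.compL ℝ E' E ℝ).flip
  have hP : HasFDerivAt (fun z ↦ P (J z)) (P ∘L D2) p := P.hasFDerivAt.comp p hJ
  have hge : HasFDerivAt (fun z ↦ g (e z)) (Dg ∘L J p) p := hg.comp p he
  have h1 : HasFDerivAt (pullForm g e J) _ p := hP.clm_comp (hge.clm_comp hJ)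
  refine ⟨_, h1, fun a b c ↦ ?_⟩
  simp [P]
  ring

/-- If `s` is a section of `R₊` and `R₊` is integrable, then `G(∇_u s, t) = 0` for `t` in `R₊`, in
coordinates. -/
theorem metric_covariant_eq_zero {g : E → E →L[ℝ] E →L[ℝ] ℝ} {e : E' → E}
    {J : E' → E' →L[ℝ] E} {p : E'} {Dg : E →L[ℝ] E →L[ℝ] E →L[ℝ] ℝ} {D2 : E' →L[ℝ] E' →L[ℝ] E}
    {f : E' → E' →L[ℝ] E' →L[ℝ] ℝ} {Df : E' →L[ℝ] E' →L[ℝ] E' →L[ℝ] ℝ}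
    {σ : E' → E'} {Dσ : E' →L[ℝ] E'} {γ : V → E'} {q : V}
    (hg : HasFDerivAt g Dg (e p)) (he : HasFDerivAt e (J p) p) (hJ : HasFDerivAt J D2 p)
    (hD2 : ∀ a b, D2 a b = D2 b a) (hf : HasFDerivAt f Df p) (hσ : HasFDerivAt σ Dσ p)
    (hgs : ∀ a b, g (e p) a b = g (e p) b a) (hDgs : ∀ a b c, Dg a b c = Dg a c b)
    (hfa : ∀ a b, f p a b = - f p b a)
    (hclosed : ∀ a b c, Df a b c - Df b a c + Df c a b = 0)
    (hker : ∀ᶠ z in 𝓝 p, ∀ w, g (e z) (J z (σ z)) (J z w) = f z (σ z) w)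
    (hp : γ q = p) (hγ : ContDiffAt ℝ 2 γ q)
    (hγker : ∀ᶠ x in 𝓝 q, ∀ a w, g (e (γ x)) (J (γ x) (fderiv ℝ γ x a)) (J (γ x) w) =
      f (γ x) (fderiv ℝ γ x a) w)
    (hrange : ∀ a, (∀ w, g (e p) (J p a) (J p w) = f p a w) → a ∈ range (fderiv ℝ γ q))
    {t : E'} (ht : ∀ w, g (e p) (J p t) (J p w) = f p t w) (u : E') :
    g (e p) (D2 u (σ p) + J p (Dσ u)) (J p t) + 1 / 2 * (Dg (J p u) (J p (σ p)) (J p t)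
      + Dg (J p (σ p)) (J p u) (J p t) - Dg (J p t) (J p u) (J p (σ p))) = 0 := by
  obtain ⟨Dh, hh, hDh⟩ := hasFDerivAt_pullForm hg he hJ
  have hH : HasFDerivAt (fun z ↦ pullForm g e J z - f z) (Dh - Df) p := hh.sub hf
  obtain ⟨a, ha⟩ := hrange t ht
  obtain ⟨b, hb⟩ := hrange (σ p) hker.self_of_nhds
  -- Integrability enters here: `t` and `σ p` are both tangent to the integral manifold at `p`.
  have hinv : (Dh - Df) t (σ p) u = (Dh - Df) (σ p) t u := by
    subst hp
    have := fderiv_form_symm_of_integral hH hγ (hγker.mono fun x hx a w ↦ by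
      simp [pullForm_apply, hx a w]) a b
    rw [ha, hb] at this
    rw [this]
  -- Derivative of `H(σ, t) = 0` along `u`; `t` is frozen as a constant vector, so only `σ` need lie
  -- in `R₊` near `p`.
  have hdiff : (Dh - Df) u (σ p) t + (pullForm g e J p (Dσ u) t - f p (Dσ u) t) = 0 := by
    have h1 := (hH.clm_apply hσ).clm_apply (hasFDerivAt_const t p)
    have h2 : (fun z ↦ (pullForm g e J z - f z) (σ z) t) =ᶠ[𝓝 p] fun _ ↦ 0 := by
      filter_upwards [hker] with z hz
      simp [pullForm_apply, hz t]
    have h3 := congrArg (fun A ↦ A u)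
      (h1.unique ((hasFDerivAt_const (0 : ℝ) p).congr_of_eventuallyEq h2))
    simp at h3 ⊢
    linarith
  have hc := hclosed (σ p) t u
  -- Since `t` is in the left kernel and `f` is alternating, the two terms in `Dσ u` add up instead
  -- of cancelling.
  have hfu : f p (Dσ u) t = - g (e p) (J p (Dσ u)) (J p t) := by
    rw [hfa, ← ht, hgs]
  simp only [_root_.sub_apply, hDh, pullForm_apply, hfu] at hinv hdiff
  -- By symmetry of `D2` and `g`, the second-derivative terms cancel in the Koszul combination
  -- except for `2 g(D2 u (σ p), J t)`.
  have e1 := hD2 t (σ p)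
  have e2 := hD2 u (σ p)
  have e3 := hD2 u t
  rw [e1, hDgs (J p t) (J p (σ p)) (J p u), hgs (J p (σ p)) (D2 t u), ← e3, ← e2,
    hgs (J p t) (D2 u (σ p))] at hinv
  rw [hgs (J p (σ p))] at hdiff
  rw [hDgs (J p (σ p)) (J p t)] at hinv
  simp only [map_add, _root_.add_apply]
  linarith

end Calculus

/-! ### Passage between the manifolds and their preferred charts. -/

section Coordinates

set_option maxSynthPendingDepth 3

variable {E : Type*} [NormedAddCommGroup E] [NormedSpace ℝ E]
  {M : Type*} [TopologicalSpace M] [ChartedSpace E M] [IsManifold 𝓘(ℝ, E) ∞ M]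
  {E' : Type*} [NormedAddCommGroup E'] [NormedSpace ℝ E']
  {Y : Type*} [TopologicalSpace Y] [ChartedSpace E' Y] [IsManifold 𝓘(ℝ, E') ∞ Y]

/-- The fibre of the tangent bundle at `x` is the model space, identified by the preferred chart at
`x` itself. Hence components at the centre of the chart need no conversion. -/
theorem toCoords_self (x : M) :
    (toCoords x x : E →L[ℝ] E) = ContinuousLinearMap.id ℝ E := by
  have h := TangentBundle.continuousLinearMapAt_trivializationAt (I := 𝓘(ℝ, E))
    (mem_chart_source E x)
  exact h.trans mfderiv_extChartAt_self

theorem toCoords_self_apply (x : M) (v : TangentSpace 𝓘(ℝ, E) x) : toCoords x x v = v :=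
  congrArg (fun A : E →L[ℝ] E ↦ A v) (toCoords_self x)

theorem ofCoords_self_apply (x : M) (v : E) : ofCoords x x v = v := by
  have h := toCoords_ofCoords x x (mem_chart_source E x) v
  rwa [toCoords_self_apply] at h

/-- The expression of a map in the preferred charts at `y` and at its image. -/
noncomputable def chartRep (e : Y → M) (y : Y) : E' → E :=
  extChartAt 𝓘(ℝ, E) (e y) ∘ e ∘ (extChartAt 𝓘(ℝ, E') y).symm

omit [IsManifold 𝓘(ℝ, E) ∞ M] [IsManifold 𝓘(ℝ, E') ∞ Y] in
theorem chartRep_extChartAt (e : Y → M) {y y' : Y} (hy' : y' ∈ (chartAt E' y).source) :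
    chartRep (E := E) (E' := E') e y (extChartAt 𝓘(ℝ, E') y y') = extChartAt 𝓘(ℝ, E) (e y) (e y') := by
  simp only [chartRep, Function.comp_apply]
  rw [(extChartAt 𝓘(ℝ, E') y).left_inv (by simpa using hy')]

omit [IsManifold 𝓘(ℝ, E) ∞ M] [IsManifold 𝓘(ℝ, E') ∞ Y] in
theorem contDiffAt_chartRep {e : Y → M} {y : Y} (he : ContMDiffAt 𝓘(ℝ, E') 𝓘(ℝ, E) ∞ e y) :
    ContDiffAt ℝ ∞ (chartRep (E := E) (E' := E') e y) (extChartAt 𝓘(ℝ, E') y y) := by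
  have := (contMDiffAt_iff.1 he).2
  rw [modelWithCornersSelf_coe, range_id] at this
  exact this.contDiffAt Filter.univ_mem

/-- Chain rule: the tangent bundle trivialization is the derivative of the chart, and its inverse
that of the inverse chart. -/
theorem fderiv_chartRep {e : Y → M} {y y' : Y} (hy' : y' ∈ (chartAt E' y).source)
    (hey' : e y' ∈ (chartAt E (e y)).source) (he : MDifferentiableAt 𝓘(ℝ, E') 𝓘(ℝ, E) e y')
    (a : E') :
    fderiv ℝ (chartRep e y) (extChartAt 𝓘(ℝ, E') y y') a =
      toCoords (e y) (e y') (mfderiv 𝓘(ℝ, E') 𝓘(ℝ, E) e y' (ofCoords y y' a)) := by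
  obtain ⟨z, hz, rfl⟩ : ∃ z ∈ (extChartAt 𝓘(ℝ, E') y).target,
      (extChartAt 𝓘(ℝ, E') y).symm z = y' := by
    have hy'' : y' ∈ (extChartAt 𝓘(ℝ, E') y).source := by simpa using hy'
    exact ⟨_, (extChartAt 𝓘(ℝ, E') y).map_source hy'', (extChartAt 𝓘(ℝ, E') y).left_inv hy''⟩
  have h1 := TangentBundle.continuousLinearMapAt_trivializationAt (I := 𝓘(ℝ, E)) hey'
  have h2 := TangentBundle.symmL_trivializationAt (I := 𝓘(ℝ, E')) hy'
  rw [(extChartAt 𝓘(ℝ, E') y).right_inv hz] at h2 ⊢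
  have h3 : MDifferentiableAt 𝓘(ℝ, E') 𝓘(ℝ, E') (extChartAt 𝓘(ℝ, E') y).symm z := by
    have := mdifferentiableWithinAt_extChartAt_symm (I := 𝓘(ℝ, E')) hz
    rwa [modelWithCornersSelf_coe, range_id, mdifferentiableWithinAt_univ] at this
  have h5 : MDifferentiableAt 𝓘(ℝ, E) 𝓘(ℝ, E) (extChartAt 𝓘(ℝ, E) (e y))
      (e ((extChartAt 𝓘(ℝ, E') y).symm z)) := mdifferentiableAt_extChartAt hey'
  have k2 := (h5.hasMFDerivAt.comp z (he.hasMFDerivAt.comp z h3.hasMFDerivAt)).mfderiv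
  rw [mfderiv_eq_fderiv] at k2
  rw [modelWithCornersSelf_coe, range_id, mfderivWithin_univ] at h2
  rw [toCoords, ofCoords, h1, h2]
  exact congrArg (fun A : E' →L[ℝ] E ↦ A a) k2

theorem eventually_fderiv_chartRep {e : Y → M} {y : Y}
    (he : ContMDiffAt 𝓘(ℝ, E') 𝓘(ℝ, E) ∞ e y) :
    ∀ᶠ y' in 𝓝 y, ∀ a, fderiv ℝ (chartRep e y) (extChartAt 𝓘(ℝ, E') y y') a =
      toCoords (e y) (e y') (mfderiv 𝓘(ℝ, E') 𝓘(ℝ, E) e y' (ofCoords y y' a)) := by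
  -- Regularity at a point spreads to a neighbourhood for finite order, so order `1` is used.
  have h1 : ContMDiffAt 𝓘(ℝ, E') 𝓘(ℝ, E) 1 e y := he.of_le (by simp)
  filter_upwards [(chartAt E' y).open_source.mem_nhds (mem_chart_source E' y),
    contMDiffAt_iff_contMDiffAt_nhds (by simp) |>.1 h1, he.continuousAt
      ((chartAt E (e y)).open_source.mem_nhds (mem_chart_source E (e y)))] with y' h1 h2 h3
  exact fderiv_chartRep h1 h3 (h2.mdifferentiableAt one_ne_zero)

/-- The components of a 2-form in the coordinate frame of the preferred chart at `y`. -/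
noncomputable def TwoForm.coords (F : TwoForm E' Y) (y y' : Y) : E' →L[ℝ] E' →L[ℝ] ℝ :=
  ContinuousLinearMap.precomp ℝ (ofCoords y y') ∘L F.val y' ∘L ofCoords y y'

theorem TwoForm.coords_apply (F : TwoForm E' Y) (y y' : Y) (a b : E') :
    F.coords y y' a b = F.val y' (ofCoords y y' a) (ofCoords y y' b) := rfl

theorem metricCoords_toCoords (G : PseudoRiemannianMetric E M) {x x' : M}
    (hx' : x' ∈ (chartAt E x).source) (v w : TangentSpace 𝓘(ℝ, E) x') :
    metricCoords G x x' (toCoords x x' v) (toCoords x x' w) = G.val x' v w := by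
  change G.val x' (ofCoords x x' (toCoords x x' v)) (ofCoords x x' (toCoords x x' w)) = _
  rw [ofCoords_toCoords x x' hx', ofCoords_toCoords x x' hx']

theorem TwoForm.mdifferentiableAt_coords (F : TwoForm E' Y) (y : Y) :
    MDifferentiableAt 𝓘(ℝ, E') 𝓘(ℝ, E' →L[ℝ] E' →L[ℝ] ℝ) (fun y' ↦ F.coords y y') y := by
  have h := (mdifferentiableAt_section _ _).1 ((F.contMDiff y).mdifferentiableAt (by simp))
  refine h.congr_of_eventuallyEq ?_
  filter_upwards [(chartAt E' y).open_source.mem_nhds (mem_chart_source E' y)] with y' hy'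
  ext v w
  simp [hom_trivializationAt_apply, ContinuousLinearMap.inCoordinates, coords, ofCoords]
  have h' : y' ∈ (trivializationAt (E' →L[ℝ] ℝ)
      (fun y ↦ TangentSpace 𝓘(ℝ, E') y →L[ℝ] ℝ) y).baseSet := by
    simpa [hom_trivializationAt_baseSet] using hy'
  rw [Trivialization.coe_linearMapAt_of_mem _ h']
  simp [hom_trivializationAt_apply, ContinuousLinearMap.inCoordinates]

theorem mvfderiv_of_chart {F : Type*} [NormedAddCommGroup F] [NormedSpace ℝ F] {h : Y → F}
    {k : E' → F} {D : E' →L[ℝ] F} {y : Y} (hk : HasFDerivAt k D (extChartAt 𝓘(ℝ, E') y y))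
    (hh : h =ᶠ[𝓝 y] fun y' ↦ k (extChartAt 𝓘(ℝ, E') y y')) (u : TangentSpace 𝓘(ℝ, E') y) :
    mvfderiv 𝓘(ℝ, E') h y u = D u := by
  have h1 : MDifferentiableAt 𝓘(ℝ, E') 𝓘(ℝ, F) h y :=
    (hk.differentiableAt.mdifferentiableAt.comp y
      (mdifferentiableAt_extChartAt (mem_chart_source E' y))).congr_of_eventuallyEq hh
  let D' : E' →L[ℝ] F := mvfderiv 𝓘(ℝ, E') h y
  have h2 : HasFDerivAt (h ∘ (extChartAt 𝓘(ℝ, E') y).symm) D' (extChartAt 𝓘(ℝ, E') y y) :=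
    hasFDerivAt_chart h1
  have h3 : h ∘ (extChartAt 𝓘(ℝ, E') y).symm =ᶠ[𝓝 (extChartAt 𝓘(ℝ, E') y y)] k := by
    have h4 := (continuousAt_extChartAt_symm (I := 𝓘(ℝ, E')) y).eventually
      (by rwa [extChartAt_to_inv])
    filter_upwards [h4, extChartAt_target_mem_nhds (I := 𝓘(ℝ, E')) y] with z hz hz'
    rw [Function.comp_apply, hz, (extChartAt 𝓘(ℝ, E') y).right_inv hz']
  exact congrArg (fun A : E' →L[ℝ] F ↦ A u) (h2.unique (hk.congr_of_eventuallyEq h3))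

/-- `dF = 0` in terms of the derivatives of the components of `F`. -/
theorem TwoForm.IsClosed.mvfderiv_coords [FiniteDimensional ℝ E'] {F : TwoForm E' Y} (hF : F.IsClosed) (y : Y)
    (a b c : TangentSpace 𝓘(ℝ, E') y) :
    mvfderiv 𝓘(ℝ, E') (fun y' ↦ F.coords y y') y a b c
      - mvfderiv 𝓘(ℝ, E') (fun y' ↦ F.coords y y') y b a c
      + mvfderiv 𝓘(ℝ, E') (fun y' ↦ F.coords y y') y c a b = 0 := by
  -- Test `dF` on extensions with constant components: the derivative terms become derivatives of
  -- the components of `F`.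
  have hd (v w z : TangentSpace 𝓘(ℝ, E') y) :
      mvfderiv 𝓘(ℝ, E') (fun y' ↦ F.val y' (FiberBundle.extend E' w y')
        (FiberBundle.extend E' z y')) y v =
      mvfderiv 𝓘(ℝ, E') (fun y' ↦ F.coords y y') y v w z := by
    obtain ⟨D, hD, hD'⟩ := hasFDerivAt_form_apply (E := E') (E' := E')
      (hasFDerivAt_chart (F.mdifferentiableAt_coords y)) w z
    rw [mvfderiv_of_chart hD]
    · exact hD' v
    · filter_upwards [(chartAt E' y).open_source.mem_nhds (mem_chart_source E' y)] with y' hy'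
      rw [extend_eq_ofCoords hy', extend_eq_ofCoords hy', toCoords_self_apply,
        toCoords_self_apply, Function.comp_apply,
        (extChartAt 𝓘(ℝ, E') y).left_inv (by simpa using hy')]
      rfl
  -- The brackets of these extensions vanish at `y`, because `coordDerivative` is torsion-free and
  -- annihilates them there.
  have hb (v w : TangentSpace 𝓘(ℝ, E') y) : VectorField.mlieBracket 𝓘(ℝ, E')
      (FiberBundle.extend E' v) (FiberBundle.extend E' w) y = 0 := by
    have : CompleteSpace E' := FiniteDimensional.complete ℝ E'
    have h := coordDerivative.torsion_apply_eq_extend (x := y) v w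
    rw [coordDerivative_torsion, coordDerivative_extend, coordDerivative_extend] at h
    simpa using h
  have hs (v : TangentSpace 𝓘(ℝ, E') y) : SmoothFieldAt (FiberBundle.extend E' v) y :=
    FiberBundle.contMDiffAt_extend _ _ _
  have h := hF y _ _ _ (hs a) (hs b) (hs c)
  rw [extDeriv, hd, hd, hd, hb, hb, hb] at h
  simpa using h

end Coordinates

/-! ### Linear algebra of the bibrane condition at one point. -/

section LinearAlgebra

variable {E E' : Type*} [NormedAddCommGroup E] [NormedSpace ℝ E] [FiniteDimensional ℝ E]
  [NormedAddCommGroup E'] [NormedSpace ℝ E']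

theorem exists_form_eq {B : E →L[ℝ] E →L[ℝ] ℝ} (hB : ∀ v, (∀ w, B v w = 0) → v = 0)
    (φ : E →ₗ[ℝ] ℝ) : ∃ v, ∀ w, B v w = φ w := by
  let f : E →ₗ[ℝ] Module.Dual ℝ E := LinearMap.mk₂ ℝ (fun v w ↦ B v w) (by simp) (by simp)
    (by simp) (by simp)
  have hf : Function.Injective f := by
    rw [injective_iff_map_eq_zero]
    exact fun v hv ↦ hB v fun w ↦ congrArg (fun A : Module.Dual ℝ E ↦ A w) hv
  obtain ⟨v, hv⟩ := (LinearMap.injective_iff_surjective_of_finrank_eq_finrank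
    Subspace.dual_finrank_eq.symm).1 hf φ
  exact ⟨v, fun w ↦ congrArg (fun A : Module.Dual ℝ E ↦ A w) hv⟩

/-- Under the topological bibrane condition `R₊` contains its own orthogonal complement. -/
theorem exists_of_orthogonal {B : E →L[ℝ] E →L[ℝ] ℝ} {d : E' →L[ℝ] E}
    {f : E' →L[ℝ] E' →L[ℝ] ℝ} (hBs : ∀ v w, B v w = B w v)
    (hB : ∀ v, (∀ w, B v w = 0) → v = 0) (hd : Function.Injective d) (hf : ∀ v, f v v = 0)
    (hbib : ∀ u v, (∀ w, B v (d w) = f u w) → ∃ v', d v' = v ∧ ∀ w, B (d u) (d w) = f v' w)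
    {v : E} (hv : ∀ t, (∀ w, B (d t) (d w) = f t w) → B v (d t) = 0) :
    ∃ r, (∀ w, B (d r) (d w) = f r w) ∧ d r = v := by
  have hfs (a b : E') : f a b = - f b a := by
    have := hf (a + b)
    simp only [map_add, _root_.add_apply, hf] at this
    linarith
  -- The bibrane condition with `u = 0`: a normal vector is tangent and lies in the kernel of `f`,
  -- hence in `R₊`.
  have hortho (k : E) (hk : ∀ w, B k (d w) = 0) : ∃ k', d k' = k ∧ ∀ w, f k' w = 0 := by
    obtain ⟨k', hk', hk''⟩ := hbib 0 k (by simpa using hk)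
    exact ⟨k', hk', fun w ↦ by simpa using (hk'' w).symm⟩
  -- Otherwise a functional vanishes on the range of `d` but not at `v`. The vector representing it
  -- is normal, so it belongs to `R₊` and must be orthogonal to `v`.
  obtain ⟨a, rfl⟩ : v ∈ LinearMap.range d.toLinearMap := by
    by_contra h
    obtain ⟨φ, hφ, hle⟩ := Submodule.exists_le_ker_of_notMem h
    obtain ⟨k, hk⟩ := exists_form_eq hB φ
    have hkd (w : E') : B k (d w) = 0 := by
      rw [hk]
      exact hle ⟨w, rfl⟩
    obtain ⟨k', rfl, hk'⟩ := hortho k hkd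
    have := hv k' fun w ↦ by rw [hkd, hk']
    rw [hBs, hk] at this
    exact hφ this
  obtain ⟨p, hp⟩ := LinearMap.exists_leftInverse_of_injective d.toLinearMap
    (LinearMap.ker_eq_bot.2 hd)
  have hpd (w : E') : p (d w) = w := LinearMap.congr_fun hp w
  -- The left inverse `p` extends `f a` to the ambient space, where nondegeneracy represents it by a
  -- vector; the bibrane condition makes that vector tangent.
  have hJ (a : E') : ∃ b, (∀ w, B (d b) (d w) = f a w) ∧ ∀ w, B (d a) (d w) = f b w := by
    obtain ⟨v, hv⟩ := exists_form_eq hB ((f a).toLinearMap ∘ₗ p)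
    have hv' (w : E') : B v (d w) = f a w := by
      rw [hv]
      exact congrArg (f a) (hpd w)
    obtain ⟨b, rfl, hb⟩ := hbib a v hv'
    exact ⟨b, hv', hb⟩
  refine ⟨a, fun w ↦ ?_, rfl⟩
  obtain ⟨b, hb, hb'⟩ := hJ w
  -- `B` and `f` exchange `w` and `b`, so `w + b` lies in `R₊`. Thus `B(da, dw) = -B(da, db) = -f(w,
  -- a) = f(a, w)`.
  have h : B (d a) (d (w + b)) = 0 := hv (w + b) fun x ↦ by simp [hb, hb', add_comm]
  simp only [map_add] at h
  rw [hfs, ← hb, hBs (d b)]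
  linarith

end LinearAlgebra

/-- In the adapted charts the map is `x ↦ (x, 0)`, so projecting to the first factor gives a local
left inverse, differentiable at `e y`. -/
theorem mfderiv_injective_of_isImmersionAt
    {E : Type*} [NormedAddCommGroup E] [NormedSpace ℝ E]
    {M : Type*} [TopologicalSpace M] [ChartedSpace E M] [IsManifold 𝓘(ℝ, E) ∞ M]
    {E' : Type*} [NormedAddCommGroup E'] [NormedSpace ℝ E']
    {Y : Type*} [TopologicalSpace Y] [ChartedSpace E' Y] [IsManifold 𝓘(ℝ, E') ∞ Y]
    {e : Y → M} {y : Y} (h : Manifold.IsImmersionAt 𝓘(ℝ, E') 𝓘(ℝ, E) ∞ e y) :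
    Function.Injective (mfderiv 𝓘(ℝ, E') 𝓘(ℝ, E) e y) := by
  let L : E →L[ℝ] E' := ContinuousLinearMap.fst ℝ E' h.complement ∘L h.equiv.symm
  have hchart (y' : Y) (hy' : y' ∈ h.domChart.source) :
      L (h.codChart (e y')) = h.domChart y' := by
    have hx : h.domChart y' ∈ (h.domChart.extend 𝓘(ℝ, E')).target := by
      simpa using h.domChart.map_source hy'
    have h1 := h.writtenInCharts hx
    have h2 : h.codChart (e y') = h.equiv (h.domChart y', 0) := by
      simpa [h.domChart.left_inv hy'] using h1
    simp [L, h2]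
  have h1 : MDifferentiableAt 𝓘(ℝ, E) 𝓘(ℝ, E) h.codChart (e y) :=
    (contMDiffAt_of_mem_maximalAtlas h.codChart_mem_maximalAtlas
      h.mem_codChart_source).mdifferentiableAt (by simp)
  have h2 : MDifferentiableAt 𝓘(ℝ, E') 𝓘(ℝ, E') h.domChart.symm (L (h.codChart (e y))) := by
    rw [hchart y h.mem_domChart_source]
    exact (contMDiffAt_symm_of_mem_maximalAtlas h.domChart_mem_maximalAtlas
      (h.domChart.map_source h.mem_domChart_source)).mdifferentiableAt (by simp)
  have h3 : MDifferentiableAt 𝓘(ℝ, E) 𝓘(ℝ, E') (h.domChart.symm ∘ L ∘ h.codChart) (e y) :=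
    h2.comp (e y) (L.differentiableAt.mdifferentiableAt.comp (e y) h1)
  have h4 : MDifferentiableAt 𝓘(ℝ, E') 𝓘(ℝ, E) e y := h.contMDiffAt.mdifferentiableAt (by simp)
  have h5 : (h.domChart.symm ∘ L ∘ h.codChart) ∘ e =ᶠ[𝓝 y] id := by
    filter_upwards [h.domChart.open_source.mem_nhds h.mem_domChart_source] with y' hy'
    simp [hchart y' hy', h.domChart.left_inv hy']
  have h6 := hasMFDerivAt_unique (h3.hasMFDerivAt.comp y h4.hasMFDerivAt)
    ((hasMFDerivAt_id y).congr_of_eventuallyEq h5)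
  intro a b hab
  have h7 (v : TangentSpace 𝓘(ℝ, E') y) := congrArg (fun A : E' →L[ℝ] E' ↦ A v) h6
  have h8 := (h7 a).symm.trans ((congrArg (mfderiv 𝓘(ℝ, E) 𝓘(ℝ, E')
    (h.domChart.symm ∘ L ∘ h.codChart) (e y)) hab).trans (h7 b))
  exact h8

/-! ### The differential identity on the manifold, and the conclusion. -/

section Parallel

set_option maxSynthPendingDepth 3

variable {E : Type*} [NormedAddCommGroup E] [NormedSpace ℝ E]
  {M : Type*} [TopologicalSpace M] [ChartedSpace E M] [IsManifold 𝓘(ℝ, E) ∞ M]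
  {E' : Type*} [NormedAddCommGroup E'] [NormedSpace ℝ E']
  {Y : Type*} [TopologicalSpace Y] [ChartedSpace E' Y] [IsManifold 𝓘(ℝ, E') ∞ Y]
  (G : PseudoRiemannianMetric E M) (F : TwoForm E' Y)

/-- The metric components near `x` as a function on the model space. -/
noncomputable def metricRep (x : M) : E → E →L[ℝ] E →L[ℝ] ℝ :=
  (fun x' ↦ metricCoords G x x') ∘ (extChartAt 𝓘(ℝ, E) x).symm

/-- The components of a 2-form near `y` as a function on the model space. -/
noncomputable def TwoForm.rep (y : Y) : E' → E' →L[ℝ] E' →L[ℝ] ℝ :=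
  (fun y' ↦ F.coords y y') ∘ (extChartAt 𝓘(ℝ, E') y).symm

variable {G F}

/-- Membership in `R₊` in terms of components. -/
theorem eventually_mem_rPlus_iff {e : Y → M} {y : Y}
    (he : ContMDiffAt 𝓘(ℝ, E') 𝓘(ℝ, E) ∞ e y) :
    ∀ᶠ y' in 𝓝 y, ∀ a : TangentSpace 𝓘(ℝ, E') y', a ∈ rPlus G e F y' ↔
      ∀ w : E', metricRep G (e y) (chartRep e y (extChartAt 𝓘(ℝ, E') y y'))
          (fderiv ℝ (chartRep e y) (extChartAt 𝓘(ℝ, E') y y') (toCoords y y' a))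
          (fderiv ℝ (chartRep e y) (extChartAt 𝓘(ℝ, E') y y') w) =
        F.rep y (extChartAt 𝓘(ℝ, E') y y') (toCoords y y' a) w := by
  filter_upwards [(chartAt E' y).open_source.mem_nhds (mem_chart_source E' y),
    eventually_fderiv_chartRep he, he.continuousAt
      ((chartAt E (e y)).open_source.mem_nhds (mem_chart_source E (e y)))] with y' h1 h2 h3 a
  have h4 (a : E') (b : E') : metricRep G (e y) (chartRep e y (extChartAt 𝓘(ℝ, E') y y'))
      (fderiv ℝ (chartRep e y) (extChartAt 𝓘(ℝ, E') y y') a)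
      (fderiv ℝ (chartRep e y) (extChartAt 𝓘(ℝ, E') y y') b) =
      G.val (e y') (mfderiv 𝓘(ℝ, E') 𝓘(ℝ, E) e y' (ofCoords y y' a))
        (mfderiv 𝓘(ℝ, E') 𝓘(ℝ, E) e y' (ofCoords y y' b)) := by
    rw [h2, h2, chartRep_extChartAt e h1, metricRep, Function.comp_apply,
      (extChartAt 𝓘(ℝ, E) (e y)).left_inv (by simpa using h3), metricCoords_toCoords G h3]
  have h5 (a : E') (b : E') : F.rep y (extChartAt 𝓘(ℝ, E') y y') a b =
      F.val y' (ofCoords y y' a) (ofCoords y y' b) := by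
    rw [TwoForm.rep, Function.comp_apply,
      (extChartAt 𝓘(ℝ, E') y).left_inv (by simpa using h1), TwoForm.coords_apply]
  simp only [h4, h5, ofCoords_toCoords y y' h1]
  refine ⟨fun h w ↦ h _, fun h w ↦ ?_⟩
  have := h (toCoords y y' w)
  rwa [ofCoords_toCoords y y' h1] at this

/-- A parametrization of an integral manifold of `R₊` in components. -/
theorem eventually_integral_rep {V : Type*} [NormedAddCommGroup V] [NormedSpace ℝ V] {j : V → Y}
    {x₀ : V} (hj : ContMDiffAt 𝓘(ℝ, V) 𝓘(ℝ, E') ∞ j x₀) {e : Y → M}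
    (he : ContMDiffAt 𝓘(ℝ, E') 𝓘(ℝ, E) ∞ e (j x₀))
    (hrange : ∀ᶠ x in 𝓝 x₀, ∀ v, mfderiv 𝓘(ℝ, V) 𝓘(ℝ, E') j x v ∈ rPlus G e F (j x)) :
    ∀ᶠ x in 𝓝 (extChartAt 𝓘(ℝ, V) x₀ x₀), ∀ a w,
      metricRep G (e (j x₀)) (chartRep e (j x₀) (chartRep j x₀ x : E'))
        (fderiv ℝ (chartRep e (j x₀)) (chartRep j x₀ x : E')
          (fderiv ℝ (chartRep j x₀ : V → E') x a))
        (fderiv ℝ (chartRep e (j x₀)) (chartRep j x₀ x : E') w) =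
          F.rep (j x₀) (chartRep j x₀ x : E') (fderiv ℝ (chartRep j x₀ : V → E') x a) w := by
  have htend : Filter.Tendsto (extChartAt 𝓘(ℝ, V) x₀).symm (𝓝 (extChartAt 𝓘(ℝ, V) x₀ x₀))
      (𝓝 x₀) := by
    have := continuousAt_extChartAt_symm (I := 𝓘(ℝ, V)) x₀
    rwa [ContinuousAt, extChartAt_to_inv] at this
  filter_upwards [htend.eventually (eventually_fderiv_chartRep hj), htend.eventually hrange,
    htend.eventually (hj.continuousAt.eventually
      (eventually_mem_rPlus_iff (G := G) (F := F) he)),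
    extChartAt_target_mem_nhds (I := 𝓘(ℝ, V)) x₀] with x h1 h2 h3 h4 a w
  rw [(extChartAt 𝓘(ℝ, V) x₀).right_inv h4] at h1
  rw [h1]
  exact (h3 _).1 (h2 _) w

/-- Puts integrability in the form required by `metric_covariant_eq_zero`: tangent vectors lie in
`R₊` near `q`, and they exhaust it at `q`. -/
theorem exists_integral_rep {e : Y → M} {y : Y} (he : ContMDiffAt 𝓘(ℝ, E') 𝓘(ℝ, E) ∞ e y)
    (hint : IsIntegrable (rPlus G e F)) :
    ∃ (r : ℕ) (q : EuclideanSpace ℝ (Fin r)) (γ : EuclideanSpace ℝ (Fin r) → E'),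
      γ q = extChartAt 𝓘(ℝ, E') y y ∧ ContDiffAt ℝ 2 γ q ∧
      (∀ᶠ x in 𝓝 q, ∀ a w, metricRep G (e y) (chartRep e y (γ x))
        (fderiv ℝ (chartRep e y) (γ x) (fderiv ℝ γ x a)) (fderiv ℝ (chartRep e y) (γ x) w) =
          F.rep y (γ x) (fderiv ℝ γ x a) w) ∧
      ∀ a : E', a ∈ rPlus G e F y → a ∈ range (fderiv ℝ γ q) := by
  obtain ⟨r, U, j, hU, h0, rfl, hj, hrange⟩ := hint y
  have hj0 : ContMDiffAt 𝓘(ℝ, EuclideanSpace ℝ (Fin r)) 𝓘(ℝ, E') ∞ j 0 :=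
    hj.contMDiffAt (hU.mem_nhds h0)
  refine ⟨r, extChartAt 𝓘(ℝ, EuclideanSpace ℝ (Fin r)) (0 : EuclideanSpace ℝ (Fin r)) 0,
    chartRep j 0, chartRep_extChartAt j (mem_chart_source _ _),
    (contDiffAt_chartRep hj0).of_le (WithTop.coe_le_coe.2 le_top),
    eventually_integral_rep hj0 he ?_, fun a ha ↦ ?_⟩
  · filter_upwards [hU.mem_nhds h0] with x hx v
    rw [← (hrange x hx).2]
    exact ⟨v, rfl⟩
  · rw [← (hrange _ h0).2] at ha
    obtain ⟨b, rfl⟩ := ha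
    refine ⟨b, ?_⟩
    rw [(eventually_fderiv_chartRep hj0).self_of_nhds b, toCoords_self_apply]
    exact congrArg (mfderiv 𝓘(ℝ, EuclideanSpace ℝ (Fin r)) 𝓘(ℝ, E') j 0)
      (ofCoords_self_apply (E := EuclideanSpace ℝ (Fin r)) 0 b)

variable [FiniteDimensional ℝ E] [FiniteDimensional ℝ E']

theorem metric_pullbackDeriv_eq_zero {e : Y → M} (he : ContMDiff 𝓘(ℝ, E') 𝓘(ℝ, E) ∞ e)
    (hF : F.IsClosed) (hint : IsIntegrable (rPlus G e F))
    {s : ∀ y : Y, TangentSpace 𝓘(ℝ, E') y} (hs : IsSmoothSectionOf (rPlus G e F) s) (y : Y)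
    (u t : TangentSpace 𝓘(ℝ, E') y) (ht : t ∈ rPlus G e F y) :
    G.val (e y) (pullbackDeriv (leviCivita G) e
      (fun y' ↦ mfderiv 𝓘(ℝ, E') 𝓘(ℝ, E) e y' (s y')) y u)
      (mfderiv 𝓘(ℝ, E') 𝓘(ℝ, E) e y t) = 0 := by
  have hmem := eventually_mem_rPlus_iff (G := G) (F := F) (he y)
  have hfd := eventually_fderiv_chartRep (he y)
  have hc : ContDiffAt ℝ 2 (chartRep e y) _ :=
    (contDiffAt_chartRep (he y)).of_le (WithTop.coe_le_coe.2 le_top)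
  have hsource := (chartAt E' y).open_source.mem_nhds (mem_chart_source E' y)
  set φ := extChartAt 𝓘(ℝ, E') y with hφ
  set p : E' := φ y with hp
  obtain ⟨σ, Dσ, hσ, hσs⟩ : ∃ (σ : E' → E') (Dσ : E' →L[ℝ] E'), HasFDerivAt σ Dσ p ∧
      ∀ z, σ z = toCoords y (φ.symm z) (s (φ.symm z)) :=
    ⟨_, _, hasFDerivAt_chart (mdifferentiableAt_toCoords
      ((hs.1 y).mdifferentiableAt (by simp))), fun z ↦ rfl⟩
  have hσp : σ p = s y := by
    rw [hσs, hp, hφ, extChartAt_to_inv, toCoords_self_apply]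
  set J : E' → E' →L[ℝ] E := fderiv ℝ (chartRep e y) with hJdef
  have hJp (a : TangentSpace 𝓘(ℝ, E') y) : J p a = mfderiv 𝓘(ℝ, E') 𝓘(ℝ, E) e y a := by
    rw [hfd.self_of_nhds a, toCoords_self_apply]
    exact congrArg (mfderiv 𝓘(ℝ, E') 𝓘(ℝ, E) e y) (ofCoords_self_apply (E := E') y a)
  have hep : chartRep e y p = extChartAt 𝓘(ℝ, E) (e y) (e y) :=
    chartRep_extChartAt e (mem_chart_source E' y)
  have hE : HasFDerivAt (chartRep e y) (J p) p := (hc.differentiableAt (by simp)).hasFDerivAt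
  have hJ : HasFDerivAt J (fderiv ℝ J p) p :=
    ((hc.fderiv_right (m := 1) (by norm_num)).differentiableAt (by simp)).hasFDerivAt
  have hD2 (a b : E') : fderiv ℝ J p a b = fderiv ℝ J p b a :=
    (hc.isSymmSndFDerivAt (by simp)).eq a b
  let Dg : E →L[ℝ] E →L[ℝ] E →L[ℝ] ℝ :=
    mvfderiv 𝓘(ℝ, E) (fun x' ↦ metricCoords G (e y) x') (e y)
  have hDg (a b c : TangentSpace 𝓘(ℝ, E) (e y)) : metricDeriv G (e y) a b c = Dg a b c := by
    rw [metricDeriv, toCoords_self_apply, toCoords_self_apply]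
    rfl
  have hg : HasFDerivAt (metricRep G (e y)) Dg (chartRep e y p) := by
    rw [hep]
    exact hasFDerivAt_chart (mdifferentiableAt_metricCoords G (e y))
  have hgp (a b : TangentSpace 𝓘(ℝ, E) (e y)) :
      metricRep G (e y) (chartRep e y p) a b = G.val (e y) a b := by
    rw [hep, metricRep, Function.comp_apply, extChartAt_to_inv,
      ← metricCoords_toCoords G (mem_chart_source E (e y)), toCoords_self_apply,
      toCoords_self_apply]
  let Df : E' →L[ℝ] E' →L[ℝ] E' →L[ℝ] ℝ := mvfderiv 𝓘(ℝ, E') (fun y' ↦ F.coords y y') y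
  have hf : HasFDerivAt (F.rep y) Df p := hasFDerivAt_chart (F.mdifferentiableAt_coords y)
  have hfa (a b : E') : F.rep y p a b = - F.rep y p b a := by
    have h (a : E') : F.rep y p a a = 0 := F.alternating _ _
    have := h (a + b)
    simp only [map_add, _root_.add_apply, h] at this
    linarith
  have htend : Filter.Tendsto φ.symm (𝓝 p) (𝓝 y) := by
    have := continuousAt_extChartAt_symm (I := 𝓘(ℝ, E')) y
    rwa [ContinuousAt, extChartAt_to_inv] at this
  have hker : ∀ᶠ z in 𝓝 p, ∀ w, metricRep G (e y) (chartRep e y z) (J z (σ z)) (J z w) =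
      F.rep y z (σ z) w := by
    filter_upwards [htend.eventually hmem, extChartAt_target_mem_nhds (I := 𝓘(ℝ, E')) y]
      with z hz hz'
    have := (hz (s (φ.symm z))).1 (hs.2 _)
    rwa [φ.right_inv hz', ← hσs] at this
  have htw (a : TangentSpace 𝓘(ℝ, E') y) : a ∈ rPlus G e F y ↔ ∀ w,
      metricRep G (e y) (chartRep e y p) (J p a) (J p w) = F.rep y p a w := by
    rw [hmem.self_of_nhds a, toCoords_self_apply]
  obtain ⟨r, q, γ, hγq, hγ, hγker, hγr⟩ := exists_integral_rep (he y) hint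
  have key := metric_covariant_eq_zero hg hE hJ hD2 hf hσ
    (fun a b ↦ (hgp a b).trans ((G.symm (e y) a b).trans (hgp b a).symm))
    (fun a b c ↦ (hDg a b c).symm.trans ((metricDeriv_symm G (e y) a b c).trans (hDg a c b))) hfa
    (hF.mvfderiv_coords y) hker hγq hγ hγker (fun a ha ↦ hγr a ((htw a).2 ha)) ((htw t).1 ht) u
  -- Near `y` the components of `de(s)` are `J(σ)`, so the product rule applies.
  have hdiff : mvfderiv 𝓘(ℝ, E') (fun y' ↦ toCoords (e y) (e y')
      (mfderiv 𝓘(ℝ, E') 𝓘(ℝ, E) e y' (s y'))) y u = fderiv ℝ J p u (σ p) + J p (Dσ u) := by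
    rw [mvfderiv_of_chart (hJ.clm_apply hσ)]
    · exact add_comm _ _
    · filter_upwards [hfd, hsource] with y' hy' hy''
      rw [hy', hσs, φ.left_inv (by simpa [hφ] using hy''), ofCoords_toCoords y y' hy'']
  -- The extension has constant components, so only the Christoffel term survives.
  have hlc : leviCivita G (FiberBundle.extend E (mfderiv 𝓘(ℝ, E') 𝓘(ℝ, E) e y (s y))) (e y) =
      christoffel G (e y) (mfderiv 𝓘(ℝ, E') 𝓘(ℝ, E) e y (s y)) := by
    rw [leviCivita_apply, coordDerivative_extend, FiberBundle.extend_apply_self, zero_add]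
  -- `A` names the sum as a tangent vector at `e y` rather than an element of the model space `E`.
  obtain ⟨A, hA⟩ : ∃ A : TangentSpace 𝓘(ℝ, E) (e y), A = fderiv ℝ J p u (σ p) + J p (Dσ u) :=
    ⟨_, rfl⟩
  rw [← hA] at key hdiff
  have h1 : pullbackDeriv (leviCivita G) e (fun y' ↦ mfderiv 𝓘(ℝ, E') 𝓘(ℝ, E) e y' (s y')) y u =
      A + christoffel G (e y)
        (mfderiv 𝓘(ℝ, E') 𝓘(ℝ, E) e y (s y)) (mfderiv 𝓘(ℝ, E') 𝓘(ℝ, E) e y u) := by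
    rw [← hdiff, ← hlc, ← ofCoords_self_apply (e y) (mvfderiv _ _ _ _)]
    rfl
  rw [h1, map_add, _root_.add_apply, metric_christoffel, christoffelFirst_apply, hDg, hDg, hDg,
    ← hgp, ← hJp, ← hJp, ← hJp, ← hσp]
  exact key

end Parallel

end Bibrane

theorem mainTheorem4
    {E : Type*} [NormedAddCommGroup E] [NormedSpace ℝ E] [FiniteDimensional ℝ E]
    {M : Type*} [TopologicalSpace M] [ChartedSpace E M] [IsManifold 𝓘(ℝ, E) ∞ M]
    {E' : Type*} [NormedAddCommGroup E'] [NormedSpace ℝ E'] [FiniteDimensional ℝ E']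
    {Y : Type*} [TopologicalSpace Y] [ChartedSpace E' Y] [IsManifold 𝓘(ℝ, E') ∞ Y]
    (G : Bibrane.PseudoRiemannianMetric E M)
    (e : Y → M) (he : Manifold.IsSmoothEmbedding 𝓘(ℝ, E') 𝓘(ℝ, E) ∞ e)
    (F : Bibrane.TwoForm E' Y) (hF : F.IsClosed)
    (hbib : Bibrane.IsTopologicalBibrane G e F)
    (hint : Bibrane.IsIntegrable (Bibrane.rPlus G e F))
    (s : ∀ y : Y, TangentSpace 𝓘(ℝ, E') y)
    (hs : Bibrane.IsSmoothSectionOf (Bibrane.rPlus G e F) s)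
    (y : Y) (u : TangentSpace 𝓘(ℝ, E') y) :
    Bibrane.pullbackDeriv (Bibrane.leviCivita G) e
        (fun y' ↦ mfderiv 𝓘(ℝ, E') 𝓘(ℝ, E) e y' (s y')) y u ∈
      (Bibrane.rPlus G e F y).map (mfderiv 𝓘(ℝ, E') 𝓘(ℝ, E) e y).toLinearMap := by
  obtain ⟨r, hr, hr'⟩ := Bibrane.exists_of_orthogonal (E := E) (E' := E') (B := G.val (e y))
    (d := mfderiv 𝓘(ℝ, E') 𝓘(ℝ, E) e y) (f := F.val y) (G.symm (e y)) (G.nondegenerate (e y))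
    (Bibrane.mfderiv_injective_of_isImmersionAt (he.isImmersion.isImmersionAt y))
    (F.alternating y) (hbib y)
    (fun t ht ↦ Bibrane.metric_pullbackDeriv_eq_zero he.contMDiff hF hint hs y u t ht)
  exact ⟨r, hr, hr'⟩
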